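/- All graphs are finite, simple and undirected. For a set $\mathcal F$ of graphs, a graph is $\mathcal F$-free if none of its induced subgraphs is isomorphic to a member of $\mathcal F$. For $k\ge 1$, the $k$-th power $G^k$ of a graph $G$ has the vertex set of $G$, and two distinct vertices are adjacent in $G^k$ if and only if their distance in $G$ is at most $k$ (vertices in different components are at infinite distance). The clique-width $\mathrm{cw}(G)$ is the least number of labels needed to construct a vertex-labelled graph isomorphic to $G$ by the operations: creation of a vertex with label $i$; disjoint union of two labelled graphs; joining by an edge each vertex with label $i$ to each vertex with label $j$, for two different labels $i\neq j$; relabelling each vertex with label $i$ by label $j$ (the graph without vertices has clique-width $0$). A set $\mathcal G$ of graphs is of power-bounded clique-width if there is an integer $k\ge 1$ with $\sup\{\mathrm{cw}(G^k) : G\in\mathcal G\}<\infty$; otherwise it is of power-unbounded clique-width. For $i\ge 1$, let $H_i$ be the graph obtained from a path with $i$ edges by attaching two pendant vertices to each of its two endpoints. For $k\ge 3$, let $\mathcal S_k$ be the class of $\{K_{1,4},C_3,\ldots,C_k,H_1,\ldots,H_k\}$-free graphs, and let $\mathcal T_k$ be the class of all graphs isomorphic to the line graph of a graph in $\mathcal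 S_k$. For a graph $G$, let $\kappa(G)\in\{0,3,4,\ldots\}\cup\{\infty\}$ be the maximum $k\geq 3$ with $G\in\mathcal S_k$, where $\kappa(G)=0$ if there is no such $k$ and $\kappa(G)=\infty$ if $G\in\mathcal S_k$ for all $k\ge 3$; define $\lambda(G)$ in the same way with $\mathcal T_k$ in place of $\mathcal S_k$. For a set $\mathcal F$ of graphs, let $\kappa(\mathcal F)=\sup\{\kappa(G): G\in\mathcal F\}$ and $\lambda(\mathcal F)=\sup\{\lambda(G): G\in\mathcal F\}$, with $\sup\emptyset=0$. **Theorem.** Let $\mathcal F$ be a set of graphs. If $\kappa(\mathcal F)<\infty$ or $\lambda(\mathcal F)<\infty$, then the class of $\mathcal F$-free graphs is of power-unbounded clique-width. -/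

import Mathlib

universe u v

namespace PowerCW

/-- A finite simple undirected graph. -/
structure FinGraph : Type (u + 1) where
  V : Type u
  [finite : Finite V]
  graph : SimpleGraph V

attribute [instance] FinGraph.finite

/-! ### Clique-width -/

/-- Expressions over the four clique-width operations, using labels from `Fin k`. -/
inductive CWTerm (k : ℕ) : Type
  | vertex (i : Fin k) : CWTerm k
  | union (s t : CWTerm k) : CWTerm k
  | join (i j : Fin k) (hij : i ≠ j) (t : CWTerm k) : CWTerm k
  | relabel (i j : Fin k) (t : CWTerm k) : CWTerm k

/-- The vertex set of the labelled graph built by an expression. -/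
def CWTerm.Vert {k : ℕ} : CWTerm k → Type
  | .vertex _ => Unit
  | .union s t => s.Vert ⊕ t.Vert
  | .join _ _ _ t => t.Vert
  | .relabel _ _ t => t.Vert

/-- The vertex labelling of the labelled graph built by an expression. -/
def CWTerm.label {k : ℕ} : (t : CWTerm k) → t.Vert → Fin k
  | .vertex i => fun _ => i
  | .union s t => Sum.elim s.label t.label
  | .join _ _ _ t => t.label
  | .relabel i j t => fun x => if t.label x = i then j else t.label x

/-- The underlying graph of the labelled graph built by an expression. -/
def CWTerm.graph {k : ℕ} : (t : CWTerm k) → SimpleGraph t.Vert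
  | .vertex _ => (⊥ : SimpleGraph Unit)
  | .union s t => SimpleGraph.sum s.graph t.graph
  | .join i j _ t => t.graph ⊔ SimpleGraph.fromRel (fun x y => t.label x = i ∧ t.label y = j)
  | .relabel _ _ t => t.graph

/-- `G` can be built with at most `k` labels. The graph without vertices needs no operation,
hence no label. -/
def BuildableWith {V : Type u} (G : SimpleGraph V) (k : ℕ) : Prop :=
  IsEmpty V ∨ ∃ t : CWTerm k, Nonempty (t.graph ≃g G)

/-- The clique-width of a graph: the least number of labels with which it can be built. -/
noncomputable def cliqueWidth (G : FinGraph.{u}) : ℕ∞ :=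
  ⨅ (k : ℕ) (_ : BuildableWith G.graph k), (k : ℕ∞)

/-- The clique-width of a set of graphs. -/
noncomputable def classCliqueWidth (𝒢 : Set FinGraph.{u}) : ℕ∞ :=
  ⨆ G ∈ 𝒢, cliqueWidth G

/-! ### Graph powers -/

/-- The `k`-th power: distinct vertices at distance at most `k` are adjacent. The extended distance
is infinite between different connected components. -/
def FinGraph.power (G : FinGraph.{u}) (k : ℕ) : FinGraph.{u} where
  V := G.V
  graph :=
    { Adj := fun x y => x ≠ y ∧ G.graph.edist x y ≤ (k : ℕ∞)
      symm := ⟨fun x y h => ⟨h.1.symm, by rw [SimpleGraph.edist_comm]; exact h.2⟩⟩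
      loopless := ⟨fun _ h => h.1 rfl⟩ }

/-- The set of all `k`-th powers of graphs in `𝒢`. -/
def classPower (𝒢 : Set FinGraph.{u}) (k : ℕ) : Set FinGraph.{u} :=
  {H | ∃ G ∈ 𝒢, H = G.power k}

/-- Some fixed positive power of the class is of bounded clique-width. -/
def PowerBoundedCliqueWidth (𝒢 : Set FinGraph.{u}) : Prop :=
  ∃ k : ℕ, 1 ≤ k ∧ classCliqueWidth (classPower 𝒢 k) < ⊤

def PowerUnboundedCliqueWidth (𝒢 : Set FinGraph.{u}) : Prop :=
  ¬ PowerBoundedCliqueWidth 𝒢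

/-! ### Forbidden induced subgraphs -/

/-- The class of `ℱ`-free graphs: no induced subgraph is isomorphic to a member of `ℱ`. -/
def Free (ℱ : Set FinGraph.{v}) : Set FinGraph.{u} :=
  {G | ∀ A ∈ ℱ, ¬ A.graph.IsIndContained G.graph}

/-- The star `K_{1,4}`. -/
def K14 : FinGraph.{0} where
  V := Fin 1 ⊕ Fin 4
  graph := completeBipartiteGraph (Fin 1) (Fin 4)

/-- The cycle `C_n` (used for `n ≥ 3`). -/
def cycle (n : ℕ) : FinGraph.{0} where
  V := Fin n
  graph := SimpleGraph.cycleGraph n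

/-- The graph `H_i` (used for `i ≥ 1`): a path with `i` edges, on the vertices `0, …, i`, with two
pendant vertices attached to each of its two endpoints; the pendant vertices `(true, _)` are
attached to `i`, and the pendant vertices `(false, _)` to `0`. -/
def graphH (i : ℕ) : FinGraph.{0} where
  V := Fin (i + 1) ⊕ (Bool × Bool)
  graph := SimpleGraph.fromRel fun x y =>
    match x, y with
    | .inl a, .inl b => (a : ℕ) + 1 = b
    | .inl a, .inr (e, _) => a = if e then Fin.last i else 0
    | _, _ => False

/-- The forbidden graphs `K_{1,4}, C_3, …, C_k, H_1, …, H_k`. -/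
def forbidden (k : ℕ) : Set FinGraph.{0} :=
  {K14} ∪ cycle '' Set.Icc 3 k ∪ graphH '' Set.Icc 1 k

/-- The class `S_k` (for `k ≥ 3`). -/
def classS (k : ℕ) : Set FinGraph.{u} := Free (forbidden k)

/-- The class `T_k` (for `k ≥ 3`) of line graphs of graphs in `S_k`, up to isomorphism. -/
def classT (k : ℕ) : Set FinGraph.{u} :=
  {G | ∃ R ∈ classS.{u} k, Nonempty (G.graph ≃g R.graph.lineGraph)}

/-! ### The parameters `κ` and `λ` -/

/-- The largest `k ≥ 3` with `G ∈ S_k`; it is `0` if there is no such `k`, and `⊤` if `G` lies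
in all the classes `S_k` (which decrease with `k`). -/
noncomputable def kappa (G : FinGraph.{u}) : ℕ∞ :=
  ⨆ (k : ℕ) (_ : 3 ≤ k ∧ G ∈ classS k), (k : ℕ∞)

/-- The largest `l ≥ 3` with `G ∈ T_l`; it is `0` if there is no such `l`, and `⊤` if `G` lies
in all the classes `T_l` (which decrease with `l`). -/
noncomputable def lambda (G : FinGraph.{u}) : ℕ∞ :=
  ⨆ (l : ℕ) (_ : 3 ≤ l ∧ G ∈ classT l), (l : ℕ∞)

noncomputable def kappaSet (ℱ : Set FinGraph.{u}) : ℕ∞ := ⨆ G ∈ ℱ, kappa G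

noncomputable def lambdaSet (ℱ : Set FinGraph.{u}) : ℕ∞ := ⨆ G ∈ ℱ, lambda G

end PowerCW

namespace PowerCW

open SimpleGraph

/-! ### Balanced cuts in clique-width expressions -/

/-! If `κ(ℱ) < ∞`, some `S_k` contains no member of `ℱ`, and a wall whose bricks have side at least
`2k + 1` is then `ℱ`-free: each of its subgraphs lies in `S_k`, because cycles are long, degrees are
at most 3 and branch vertices are far apart. If `λ(ℱ) < ∞`, line graphs of walls play the same role,
since their induced subgraphs are line graphs of subgraphs of the wall.

It remains to see that large walls, and their line graphs, have powers of large clique-width. An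
expression with `w` labels yields a set `A` splitting the grid terminals in a balanced way, in which
equally labelled vertices have the same neighbours outside (`CWTerm.exists_balanced_cut`). A fixed
power still has bounded degree, so only boundedly many vertices of `A` have a neighbour outside `A`
(`CutBy.ncard_boundary_le`). These meet few rows and few columns; all other rows and columns lie on
one side, which leaves too few terminals for the other (`GridModel.not_buildableWith_power`). -/

instance CWTerm.finite_vert {k : ℕ} : (t : CWTerm k) → Finite t.Vert
  | .vertex _ => inferInstanceAs (Finite Unit)
  | .union s t =>
    have := s.finite_vert
    have := t.finite_vert
    inferInstanceAs (Finite (s.Vert ⊕ t.Vert))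
  | .join _ _ _ t => t.finite_vert
  | .relabel _ _ t => t.finite_vert

/-- The set `A` is cut off by `l`: vertices of `A` with equal `l`-value have the same neighbours
outside `A`. -/
def CutBy {V : Type u} {k : ℕ} (G : SimpleGraph V) (l : V → Fin k) (A : Set V) : Prop :=
  ∀ a ∈ A, ∀ a' ∈ A, l a = l a' → ∀ b ∉ A, G.Adj a b → G.Adj a' b

theorem ncard_image_inter {α : Type u} {β : Type v} {f : α → β} (hf : f.Injective) (A : Set α)
    (X : Set β) : (f '' A ∩ X).ncard = (A ∩ f ⁻¹' X).ncard := by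
  rw [← Set.image_inter_preimage, Set.ncard_image_of_injective _ hf]

/-- Descend into the operand with more of `X` until at most `2N/3` of `X` remains; each descent
keeps at least half of more than `2N/3`. `A` is the vertex set of the subexpression reached and `l`
its labelling there. `N` stays fixed while `X` shrinks. The clause that `l` refines the final
labelling on `A` is what carries the induction through later joins. -/
theorem CWTerm.exists_balanced_cut {k : ℕ} (t : CWTerm k) {N : ℕ} (hN : 2 ≤ N) (X : Set t.Vert)
    (hX : N ≤ 3 * X.ncard) :
    ∃ (A : Set t.Vert) (l : t.Vert → Fin k), N ≤ 3 * (A ∩ X).ncard ∧ 3 * (A ∩ X).ncard ≤ 2 * N ∧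
      (∀ a ∈ A, ∀ a' ∈ A, l a = l a' → t.label a = t.label a') ∧ CutBy t.graph l A := by
  by_cases hle : 3 * X.ncard ≤ 2 * N
  · exact ⟨Set.univ, t.label, by simpa using hX, by simpa using hle, fun _ _ _ _ h => h,
      fun _ _ _ _ _ b hb => (hb trivial).elim⟩
  induction t with
  | vertex i =>
    -- A leaf is never too heavy: `3 ≤ 2 * N`, by `hN`.
    have : X.ncard ≤ 1 := (Set.ncard_le_card X).trans (by simp [CWTerm.Vert])
    omega
  | union s t ihs iht =>
    have hsplit : X.ncard ≤ (Sum.inl ⁻¹' X : Set s.Vert).ncard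
        + (Sum.inr ⁻¹' X : Set t.Vert).ncard := by
      rw [← Set.ncard_image_of_injective _ (Sum.inl_injective (α := s.Vert) (β := t.Vert)),
        ← Set.ncard_image_of_injective _ (Sum.inr_injective (α := s.Vert) (β := t.Vert))]
      refine le_trans (Set.ncard_le_ncard ?_ ?_) (Set.ncard_union_le _ _)
      · rintro (x | x) hx
        · exact Or.inl ⟨x, hx, rfl⟩
        · exact Or.inr ⟨x, hx, rfl⟩
      · exact @Set.toFinite (s.Vert ⊕ t.Vert) _ _
    rcases le_or_gt (Sum.inl ⁻¹' X : Set s.Vert).ncard (Sum.inr ⁻¹' X : Set t.Vert).ncard with h | h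
    · obtain ⟨A, l, h1, h2, h3, h4⟩ :
          ∃ (A : Set t.Vert) (l : t.Vert → Fin k), N ≤ 3 * (A ∩ Sum.inr ⁻¹' X).ncard ∧
            3 * (A ∩ Sum.inr ⁻¹' X).ncard ≤ 2 * N ∧
            (∀ a ∈ A, ∀ a' ∈ A, l a = l a' → t.label a = t.label a') ∧ CutBy t.graph l A := by
        by_cases h' : 3 * (Sum.inr ⁻¹' X : Set t.Vert).ncard ≤ 2 * N
        · exact ⟨Set.univ, t.label, by simp; omega, by simpa using h', fun _ _ _ _ h => h,
            fun _ _ _ _ _ b hb => (hb trivial).elim⟩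
        · exact iht _ (by omega) h'
      have hA : (Sum.inr '' A ∩ X : Set (s.Vert ⊕ t.Vert)).ncard = (A ∩ Sum.inr ⁻¹' X).ncard :=
        ncard_image_inter Sum.inr_injective A X
      refine ⟨(Sum.inr '' A : Set (s.Vert ⊕ t.Vert)), Sum.elim s.label l, hA ▸ h1, hA ▸ h2, ?_, ?_⟩
      · rintro _ ⟨a, ha, rfl⟩ _ ⟨a', ha', rfl⟩ hl
        exact h3 a ha a' ha' hl
      · rintro _ ⟨a, ha, rfl⟩ _ ⟨a', ha', rfl⟩ hl (b | b) hb hab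
        · exact (Bool.false_ne_true hab).elim
        · exact h4 a ha a' ha' hl b (fun hbA => hb ⟨b, hbA, rfl⟩) hab
    · obtain ⟨A, l, h1, h2, h3, h4⟩ :
          ∃ (A : Set s.Vert) (l : s.Vert → Fin k), N ≤ 3 * (A ∩ Sum.inl ⁻¹' X).ncard ∧
            3 * (A ∩ Sum.inl ⁻¹' X).ncard ≤ 2 * N ∧
            (∀ a ∈ A, ∀ a' ∈ A, l a = l a' → s.label a = s.label a') ∧ CutBy s.graph l A := by
        by_cases h' : 3 * (Sum.inl ⁻¹' X : Set s.Vert).ncard ≤ 2 * N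
        · exact ⟨Set.univ, s.label, by simp; omega, by simpa using h', fun _ _ _ _ h => h,
            fun _ _ _ _ _ b hb => (hb trivial).elim⟩
        · exact ihs _ (by omega) h'
      have hA : (Sum.inl '' A ∩ X : Set (s.Vert ⊕ t.Vert)).ncard = (A ∩ Sum.inl ⁻¹' X).ncard :=
        ncard_image_inter Sum.inl_injective A X
      refine ⟨(Sum.inl '' A : Set (s.Vert ⊕ t.Vert)), Sum.elim l t.label, hA ▸ h1, hA ▸ h2, ?_, ?_⟩
      · rintro _ ⟨a, ha, rfl⟩ _ ⟨a', ha', rfl⟩ hl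
        exact h3 a ha a' ha' hl
      · rintro _ ⟨a, ha, rfl⟩ _ ⟨a', ha', rfl⟩ hl (b | b) hb hab
        · exact h4 a ha a' ha' hl b (fun hbA => hb ⟨b, hbA, rfl⟩) hab
        · exact (Bool.false_ne_true hab).elim
  | join i j hij t ih =>
    obtain ⟨A, l, h1, h2, h3, h4⟩ := ih X hX hle
    refine ⟨A, l, h1, h2, h3, ?_⟩
    rintro a ha a' ha' hl b hb (hab | hab)
    · exact Or.inl (h4 a ha a' ha' hl b hb hab)
    · refine Or.inr ⟨fun h => hb (h ▸ ha'), ?_⟩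
      -- Vertices with equal `l` still have equal labels here, so the join treats them alike.
      have h : t.label a' = t.label a := (h3 a ha a' ha' hl).symm
      exact hab.2.imp (fun h' => ⟨h.trans h'.1, h'.2⟩) fun h' => ⟨h'.1, h.trans h'.2⟩
  | relabel i j t ih =>
    obtain ⟨A, l, h1, h2, h3, h4⟩ := ih X hX hle
    refine ⟨A, l, h1, h2, fun a ha a' ha' hl => ?_, h4⟩
    simp only [CWTerm.label, h3 a ha a' ha' hl]

theorem BuildableWith.exists_balanced_cut {V : Type u} {G : SimpleGraph V} {k : ℕ}
    (hG : BuildableWith G k) (X : Set V) (hX : 2 ≤ X.ncard) :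
    ∃ (A : Set V) (l : V → Fin k), X.ncard ≤ 3 * (A ∩ X).ncard ∧
      3 * (A ∩ X).ncard ≤ 2 * X.ncard ∧ CutBy G l A := by
  rcases hG with hV | ⟨t, ⟨e⟩⟩
  · simp [Set.eq_empty_of_isEmpty X] at hX
  have hc (Y : Set V) : (e ⁻¹' Y).ncard = Y.ncard :=
    Set.ncard_preimage_of_injective_subset_range e.injective (by simp [e.surjective.range_eq])
  obtain ⟨A, l, h1, h2, -, h4⟩ := t.exists_balanced_cut hX (e ⁻¹' X) (by rw [hc]; omega)
  have hA : e ⁻¹' (e.symm ⁻¹' A ∩ X) = A ∩ e ⁻¹' X := by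
    ext x
    simp
  refine ⟨e.symm ⁻¹' A, l ∘ e.symm, ?_, ?_, ?_⟩
  · rwa [← hc (_ ∩ X), hA]
  · rwa [← hc (_ ∩ X), hA]
  · intro a ha a' ha' hl b hb hab
    have := h4 _ ha _ ha' hl _ hb (e.symm.map_rel_iff.2 hab)
    exact e.symm.map_rel_iff.1 this

theorem cliqueWidth_le_iff {G : FinGraph.{u}} {w : ℕ} :
    cliqueWidth G ≤ w ↔ ∃ k ≤ w, BuildableWith G.graph k := by
  constructor
  · intro h
    by_contra! hc
    have : ((w + 1 : ℕ) : ℕ∞) ≤ cliqueWidth G :=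
      le_iInf₂ fun k hk => Nat.cast_le.2 (by by_contra! h'; exact hc k (by omega) hk)
    have := Nat.cast_le.1 (this.trans h)
    omega
  · rintro ⟨k, hk, hb⟩
    exact (iInf₂_le k hb).trans (Nat.cast_le.2 hk)

/-! ### Powers of graphs of bounded degree -/

theorem ncard_ball_le {V : Type u} [Finite V] (G : SimpleGraph V) {D : ℕ}
    (hD : ∀ v, (G.neighborSet v).ncard ≤ D) (v : V) (p : ℕ) :
    {x | G.edist v x ≤ (p : ℕ∞)}.ncard ≤ (D + 1) ^ p := by
  classical
  induction p with
  | zero =>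
    have : {x | G.edist v x ≤ ((0 : ℕ) : ℕ∞)} = {v} := by
      ext x
      rw [Set.mem_ofPred_eq, Nat.cast_zero, nonpos_iff_eq_zero, SimpleGraph.edist_eq_zero_iff,
        Set.mem_singleton_iff, eq_comm]
    rw [this, Set.ncard_singleton, pow_zero]
  | succ p ih =>
    set B := {x | G.edist v x ≤ (p : ℕ∞)} with hB
    have hfin : B.Finite := Set.toFinite B
    have hsub : {x | G.edist v x ≤ ((p + 1 : ℕ) : ℕ∞)} ⊆
        ⋃ y ∈ hfin.toFinset, insert y (G.neighborSet y) := by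
      intro x hx
      simp only [Set.mem_iUnion, Set.Finite.mem_toFinset, exists_prop]
      by_cases hxB : x ∈ B
      · exact ⟨x, hxB, Or.inl rfl⟩
      have hne : G.edist v x ≠ ⊤ := ne_top_of_le_ne_top (by simp) hx
      obtain ⟨q, hq⟩ := (edist_ne_top_iff_reachable.1 hne).exists_walk_length_eq_edist
      have hx' : (q.length : ℕ∞) ≤ ((p + 1 : ℕ) : ℕ∞) := hq ▸ hx
      have hlen := Nat.cast_le.1 hx'
      -- Reversing the walk exposes the neighbour `y` of `x` that is one step closer to `v`.
      obtain ⟨r, hr⟩ : ∃ r : G.Walk x v, r.length = q.length := ⟨q.reverse, by simp⟩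
      cases r with
      | nil => exact absurd (by simp [hB]) hxB
      | cons h r =>
        rename_i y
        refine ⟨y, ?_, Or.inr h.symm⟩
        rw [Walk.length_cons] at hr
        change G.edist v y ≤ p
        rw [SimpleGraph.edist_comm]
        exact r.edist_le.trans (Nat.cast_le.2 (by omega))
    calc _ ≤ (⋃ y ∈ hfin.toFinset, insert y (G.neighborSet y)).ncard :=
          Set.ncard_le_ncard hsub (Set.toFinite _)
      _ ≤ ∑ y ∈ hfin.toFinset, (insert y (G.neighborSet y)).ncard :=
          Finset.set_ncard_biUnion_le _ _
      _ ≤ ∑ y ∈ hfin.toFinset, (D + 1) := Finset.sum_le_sum fun y _ =>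
          (Set.ncard_insert_le _ _).trans (Nat.succ_le_succ (hD y))
      _ = B.ncard * (D + 1) := by
          rw [Finset.sum_const, smul_eq_mul, ← Set.ncard_eq_toFinset_card B hfin]
      _ ≤ (D + 1) ^ (p + 1) := by
          rw [pow_succ]
          exact Nat.mul_le_mul_right _ ih

/-- The vertices of `A` with a neighbour outside `A`. -/
def boundary {V : Type u} (G : SimpleGraph V) (A : Set V) : Set V :=
  {a | a ∈ A ∧ ∃ b ∉ A, G.Adj a b}

/-- All boundary vertices with one label share a neighbour outside `A`, so there are at most `D` of
them. -/
theorem CutBy.ncard_boundary_le {V : Type u} [Finite V] {G : SimpleGraph V} {k D : ℕ}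
    {l : V → Fin k} {A : Set V} (h : CutBy G l A) (hD : ∀ v, (G.neighborSet v).ncard ≤ D) :
    (boundary G A).ncard ≤ k * D := by
  classical
  have hsub : boundary G A ⊆ ⋃ c ∈ (Finset.univ : Finset (Fin k)), {a ∈ boundary G A | l a = c} := by
    intro a ha
    simpa using ha
  calc _ ≤ _ := Set.ncard_le_ncard hsub (Set.toFinite _)
    _ ≤ ∑ c, {a ∈ boundary G A | l a = c}.ncard := Finset.set_ncard_biUnion_le _ _
    _ ≤ ∑ c : Fin k, D := Finset.sum_le_sum fun c _ => ?_
    _ = k * D := by simp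
  rcases Set.eq_empty_or_nonempty {a ∈ boundary G A | l a = c} with h0 | ⟨a, ⟨haA, b, hb, hab⟩, hc⟩
  · simp [h0]
  · refine (Set.ncard_le_ncard ?_ (Set.toFinite _)).trans (hD b)
    rintro a' ⟨⟨ha', -⟩, hc'⟩
    exact (h a haA a' ha' (hc.trans hc'.symm) b hb hab).symm

theorem boundary_mono {V : Type u} {G H : SimpleGraph V} (h : G ≤ H) (A : Set V) :
    boundary G A ⊆ boundary H A :=
  fun _ ⟨ha, b, hb, hab⟩ => ⟨ha, b, hb, h hab⟩

theorem FinGraph.le_power (G : FinGraph.{u}) {p : ℕ} (hp : 1 ≤ p) :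
    G.graph ≤ (G.power p).graph := by
  intro a b hab
  refine ⟨hab.ne, ?_⟩
  rw [SimpleGraph.edist_eq_one_iff_adj.2 hab]
  exact_mod_cast hp

theorem FinGraph.ncard_neighborSet_power_le (G : FinGraph.{u}) {D : ℕ}
    (hD : ∀ v, (G.graph.neighborSet v).ncard ≤ D) (p : ℕ) (v : G.V) :
    ((G.power p).graph.neighborSet v).ncard ≤ (D + 1) ^ p :=
  (Set.ncard_le_ncard (fun _ h => h.2) (Set.toFinite _)).trans (ncard_ball_le G.graph hD v p)

/-! ### Grid models -/

/-- `u` and `v` are joined by a walk of `G` inside `S`. -/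
def JoinedIn {V : Type u} (G : SimpleGraph V) (S : Set V) : V → V → Prop :=
  Relation.ReflTransGen fun a b => G.Adj a b ∧ a ∈ S ∧ b ∈ S

theorem JoinedIn.symm {V : Type u} {G : SimpleGraph V} {S : Set V} {a b : V}
    (h : JoinedIn G S a b) : JoinedIn G S b a :=
  haveI : Std.Symm fun a b => G.Adj a b ∧ a ∈ S ∧ b ∈ S := ⟨fun _ _ h => ⟨h.1.symm, h.2.2, h.2.1⟩⟩
  Std.Symm.symm (r := Relation.ReflTransGen fun a b => G.Adj a b ∧ a ∈ S ∧ b ∈ S) _ _ h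

/-- A walk can leave `A` only from a boundary vertex. -/
theorem JoinedIn.mem_of_disjoint_boundary {V : Type u} {G : SimpleGraph V} {S A : Set V} {a b : V}
    (h : JoinedIn G S a b) (hA : ∀ v ∈ boundary G A, v ∉ S) (ha : a ∈ A) : b ∈ A := by
  induction h with
  | refl => exact ha
  | tail _ hbc ih =>
    by_contra hc
    exact hA _ ⟨ih, _, hc, hbc.1⟩ hbc.2.1

theorem JoinedIn.comap {V : Type u} {W : Type v} {G : SimpleGraph W} {f : V → W}
    (hf : f.Injective) {S : Set W} (hS : S ⊆ Set.range f) {a b : V} (h : JoinedIn G S (f a) (f b)) :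
    JoinedIn (G.comap f) (f ⁻¹' S) a b := by
  suffices H : ∀ c, JoinedIn G S (f a) c → ∃ d, f d = c ∧ JoinedIn (G.comap f) (f ⁻¹' S) a d by
    obtain ⟨d, hd, h'⟩ := H _ h
    rwa [hf hd] at h'
  intro c hc
  induction hc with
  | refl => exact ⟨a, rfl, .refl⟩
  | tail _ hbc ih =>
    obtain ⟨d, rfl, hd⟩ := ih
    obtain ⟨e, rfl⟩ := hS hbc.2.2
    exact ⟨e, rfl, hd.tail ⟨hbc.1, hbc.2.1, hbc.2.2⟩⟩

theorem lineGraph_joinedIn_of_mem {V : Type u} {G : SimpleGraph V} {T : Set G.edgeSet}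
    {e f : G.edgeSet} {v : V} (he : v ∈ e.1) (hf : v ∈ f.1) (heT : e ∈ T) (hfT : f ∈ T) :
    JoinedIn G.lineGraph T e f := by
  by_cases h : e = f
  · exact h ▸ .refl
  · exact .single ⟨⟨h, v, he, hf⟩, heT, hfT⟩

/-- Consecutive edges of a walk share a vertex, so they form a walk in the line graph. -/
theorem JoinedIn.lineGraph {V : Type u} {G : SimpleGraph V} {S : Set V} {a b : V}
    (h : JoinedIn G S a b) {e f : G.edgeSet} (he : a ∈ e.1) (hf : b ∈ f.1)
    (heS : ∀ v ∈ e.1, v ∈ S) (hfS : ∀ v ∈ f.1, v ∈ S) :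
    JoinedIn G.lineGraph {g | ∀ v ∈ g.1, v ∈ S} e f := by
  induction h generalizing f with
  | refl => exact lineGraph_joinedIn_of_mem he hf heS hfS
  | @tail b c _ hbc ih =>
    have hgS : ∀ v ∈ s(b, c), v ∈ S := by
      intro v hv
      rcases Sym2.mem_iff.1 hv with rfl | rfl
      exacts [hbc.2.1, hbc.2.2]
    have h1 := ih (f := ⟨s(b, c), hbc.1⟩) (Sym2.mem_mk_left _ _) hgS
    exact h1.trans (lineGraph_joinedIn_of_mem (Sym2.mem_mk_right b c) hf hgS hfS)

/-- Pairwise disjoint rows and pairwise disjoint columns in `G`, with terminals `t i j` in the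
intersections, so that the terminals of a row (column) are joined inside it. -/
structure GridModel {V : Type u} (G : SimpleGraph V) (n : ℕ) where
  row : Fin n → Set V
  col : Fin n → Set V
  t : Fin n → Fin n → V
  row_unique : ∀ {v i j}, v ∈ row i → v ∈ row j → i = j
  col_unique : ∀ {v i j}, v ∈ col i → v ∈ col j → i = j
  mem_row : ∀ i j, t i j ∈ row i
  mem_col : ∀ i j, t i j ∈ col j
  row_joined : ∀ i j j', JoinedIn G (row i) (t i j) (t i j')
  col_joined : ∀ i i' j, JoinedIn G (col j) (t i j) (t i' j)

namespace GridModel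

variable {V : Type u} {G : SimpleGraph V} {n : ℕ}

theorem injective_t (M : GridModel G n) : Function.Injective fun q : Fin n × Fin n => M.t q.1 q.2 := by
  rintro ⟨i, j⟩ ⟨i', j'⟩ (h : M.t i j = M.t i' j')
  exact Prod.ext (M.row_unique (M.mem_row i j) (h ▸ M.mem_row i' j'))
    (M.col_unique (M.mem_col i j) (h ▸ M.mem_col i' j'))

/-- A grid model whose rows and columns lie in the range of `f` can be pulled back along `f`. -/
def comap {W : Type v} (M : GridModel G n) (f : W → V) (hf : f.Injective) (t : Fin n → Fin n → W)
    (ht : ∀ i j, f (t i j) = M.t i j) (hrow : ∀ i, M.row i ⊆ Set.range f)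
    (hcol : ∀ j, M.col j ⊆ Set.range f) : GridModel (G.comap f) n where
  row i := f ⁻¹' M.row i
  col i := f ⁻¹' M.col i
  t := t
  row_unique h h' := M.row_unique h h'
  col_unique h h' := M.col_unique h h'
  mem_row i j := by simpa [ht] using M.mem_row i j
  mem_col i j := by simpa [ht] using M.mem_col i j
  row_joined i j j' := JoinedIn.comap hf (hrow i) (by simpa [ht] using M.row_joined i j j')
  col_joined i i' j := JoinedIn.comap hf (hcol j) (by simpa [ht] using M.col_joined i i' j)

/-- If every terminal has a neighbour in its row and column, then the line graph has a grid model
as well. -/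
def lineGraph (M : GridModel G n) (s : Fin n → Fin n → V) (hs : ∀ i j, G.Adj (M.t i j) (s i j))
    (hrow : ∀ i j, s i j ∈ M.row i) (hcol : ∀ i j, s i j ∈ M.col j) :
    GridModel G.lineGraph n where
  row i := {e | ∀ v ∈ e.1, v ∈ M.row i}
  col j := {e | ∀ v ∈ e.1, v ∈ M.col j}
  -- A terminal must now be an edge common to row and column, hence the companion `s i j`.
  t i j := ⟨s(M.t i j, s i j), hs i j⟩
  row_unique {e i j} h h' := M.row_unique (h _ e.1.out_fst_mem) (h' _ e.1.out_fst_mem)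
  col_unique {e i j} h h' := M.col_unique (h _ e.1.out_fst_mem) (h' _ e.1.out_fst_mem)
  mem_row i j v hv := by
    rcases Sym2.mem_iff.1 hv with rfl | rfl
    exacts [M.mem_row i j, hrow i j]
  mem_col i j v hv := by
    rcases Sym2.mem_iff.1 hv with rfl | rfl
    exacts [M.mem_col i j, hcol i j]
  row_joined i j j' := by
    refine (M.row_joined i j j').lineGraph (Sym2.mem_mk_left _ _) (Sym2.mem_mk_left _ _) ?_ ?_ <;>
    · intro v hv
      rcases Sym2.mem_iff.1 hv with rfl | rfl
      exacts [M.mem_row _ _, hrow _ _]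
  col_joined i i' j := by
    refine (M.col_joined i i' j).lineGraph (Sym2.mem_mk_left _ _) (Sym2.mem_mk_left _ _) ?_ ?_ <;>
    · intro v hv
      rcases Sym2.mem_iff.1 hv with rfl | rfl
      exacts [M.mem_col _ _, hcol _ _]

end GridModel

/-- Disjointness makes the choice of a vertex of `B` in each touched set injective. -/
theorem ncard_touched_le {V : Type u} [Finite V] {n : ℕ} {S : Fin n → Set V}
    (hS : ∀ {v i j}, v ∈ S i → v ∈ S j → i = j) (B : Set V) :
    {i | ∃ v ∈ B, v ∈ S i}.ncard ≤ B.ncard := by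
  classical
  choose f hf using fun i : {i | ∃ v ∈ B, v ∈ S i} => i.2
  rw [← Nat.card_coe_set_eq, ← Nat.card_coe_set_eq]
  refine Nat.card_le_card_of_injective (fun i => (⟨f i, (hf i).1⟩ : B)) fun i j hij => ?_
  have h : f i = f j := congrArg Subtype.val hij
  exact Subtype.ext (hS (hf i).2 (h ▸ (hf j).2))

/-- A power of a graph of bounded degree with a large grid model has large clique-width. -/
theorem GridModel.not_buildableWith_power {G : FinGraph.{u}} {n D p w : ℕ}
    (M : GridModel G.graph n) (hD : ∀ v, (G.graph.neighborSet v).ncard ≤ D) (hp : 1 ≤ p)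
    (hn : 2 ≤ n) (hw : 2 * (w * (D + 1) ^ p) < n) : ¬ BuildableWith (G.power p).graph w := by
  intro hb
  set τ : Fin n × Fin n → G.V := fun q => M.t q.1 q.2
  have hX : (Set.range τ).ncard = n * n := by
    rw [← Set.image_univ, Set.ncard_image_of_injective _ M.injective_t, Set.ncard_univ]
    simp
  have h2X : 2 ≤ (Set.range τ).ncard := by
    rw [hX]
    nlinarith
  obtain ⟨A, l, h1, h2, h3⟩ : ∃ (A : Set G.V) (l : G.V → Fin w),
      (Set.range τ).ncard ≤ 3 * (A ∩ Set.range τ).ncard ∧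
      3 * (A ∩ Set.range τ).ncard ≤ 2 * (Set.range τ).ncard ∧ CutBy (G.power p).graph l A :=
    hb.exists_balanced_cut (Set.range τ) h2X
  have hI : (A ∩ Set.range τ).ncard = (τ ⁻¹' A).ncard := by
    rw [Set.inter_comm, ← Set.image_univ, ncard_image_inter M.injective_t, Set.univ_inter]
  rw [hX, hI] at h1 h2
  set b := w * (D + 1) ^ p 
  have hB : (boundary G.graph A).ncard ≤ b :=
    (Set.ncard_le_ncard (boundary_mono (G.le_power hp) A) (Set.toFinite _)).trans
      (h3.ncard_boundary_le (G.ncard_neighborSet_power_le hD p))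
  set P := {i | ∃ v ∈ boundary G.graph A, v ∈ M.row i}
  set Q := {j | ∃ v ∈ boundary G.graph A, v ∈ M.col j}
  have hP : P.ncard ≤ b := (ncard_touched_le M.row_unique _).trans hB
  have hQ : Q.ncard ≤ b := (ncard_touched_le M.col_unique _).trans hB
  have hPQ : (P ×ˢ Q).ncard ≤ b * b := by
    rw [Set.ncard_prod]
    exact Nat.mul_le_mul hP hQ
  have hrow : ∀ i ∉ P, ∀ j j', M.t i j ∈ A → M.t i j' ∈ A := fun i hi j j' =>
    (M.row_joined i j j').mem_of_disjoint_boundary fun v hv hv' => hi ⟨v, hv, hv'⟩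
  have hcol : ∀ j ∉ Q, ∀ i i', M.t i j ∈ A → M.t i' j ∈ A := fun j hj i i' =>
    (M.col_joined i i' j).mem_of_disjoint_boundary fun v hv hv' => hj ⟨v, hv, hv'⟩
  have hex : ∀ P : Set (Fin n), P.ncard ≤ b → ∃ i, i ∉ P := by
    intro P hP
    by_contra! h
    rw [Set.eq_univ_of_forall h, Set.ncard_univ, Nat.card_eq_fintype_card, Fintype.card_fin] at hP
    omega
  -- The crossing of an untouched row and an untouched column decides which side is the large one.
  obtain ⟨i₀, hi₀⟩ := hex P hP
  obtain ⟨j₀, hj₀⟩ := hex Q hQ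
  have hsum := Set.ncard_add_ncard_compl (τ ⁻¹' A)
  have hcard : Nat.card (Fin n × Fin n) = n * n := by simp
  rw [hcard] at hsum
  by_cases h0 : M.t i₀ j₀ ∈ A
  -- If row `i` or column `j` is untouched, it links `t i j` to `t i₀ j₀` through an untouched
  -- column or row. So one side has at most `b²` terminals, less than `n²/4`, while balance demands
  -- `n²/3`.
  · have : (τ ⁻¹' A)ᶜ ⊆ P ×ˢ Q := by
      rintro ⟨i, j⟩ hij
      refine ⟨by_contra fun hi => hij ?_, by_contra fun hj => hij ?_⟩
      · exact hrow i hi j₀ j (hcol j₀ hj₀ i₀ i h0)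
      · exact hcol j hj i₀ i (hrow i₀ hi₀ j₀ j h0)
    have := (Set.ncard_le_ncard this (Set.toFinite _)).trans hPQ
    nlinarith
  · have : τ ⁻¹' A ⊆ P ×ˢ Q := by
      rintro ⟨i, j⟩ hij
      refine ⟨by_contra fun hi => h0 ?_, by_contra fun hj => h0 ?_⟩
      · exact hcol j₀ hj₀ i i₀ (hrow i hi j j₀ hij)
      · exact hrow i₀ hi₀ j j₀ (hcol j hj i i₀ hij)
    have := (Set.ncard_le_ncard this (Set.toFinite _)).trans hPQ
    nlinarith

theorem ncard_neighborSet_lineGraph_le {V : Type u} [Finite V] {G : SimpleGraph V} {D : ℕ}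
    (hD : ∀ v, (G.neighborSet v).ncard ≤ D) (e : G.edgeSet) :
    (G.lineGraph.neighborSet e).ncard ≤ D + D := by
  obtain ⟨⟨a, b⟩, hab⟩ := e
  rw [← Set.ncard_image_of_injective _ Subtype.val_injective]
  have hsub : Subtype.val '' G.lineGraph.neighborSet ⟨s(a, b), hab⟩ ⊆
      (fun x => s(a, x)) '' G.neighborSet a ∪ (fun x => s(b, x)) '' G.neighborSet b := by
    rintro _ ⟨⟨f, hf⟩, ⟨-, v, hv, hvf⟩, rfl⟩
    obtain ⟨y, rfl⟩ := Sym2.mem_iff_exists.1 (show v ∈ f from hvf)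
    rcases Sym2.mem_iff.1 (show v ∈ s(a, b) from hv) with rfl | rfl
    · exact Or.inl ⟨y, hf, rfl⟩
    · exact Or.inr ⟨y, hf, rfl⟩
  calc _ ≤ _ := Set.ncard_le_ncard hsub (Set.toFinite _)
    _ ≤ _ := Set.ncard_union_le _ _
    _ ≤ _ := Nat.add_le_add ((Set.ncard_image_le (Set.toFinite _)).trans (hD a))
      ((Set.ncard_image_le (Set.toFinite _)).trans (hD b))

/-! ### The wall -/

/-- The infinite wall with bricks of height `m` and length `2 * m`. -/
def wall (m : ℕ) : SimpleGraph (ℕ × ℕ) :=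
  .fromRel fun p q => (m ∣ p.2 ∧ q.2 = p.2 ∧ q.1 = p.1 + 1) ∨
    (2 * m ∣ p.1 + m * (p.2 / m) ∧ q.1 = p.1 ∧ q.2 = p.2 + 1)

variable {m : ℕ} {p q : ℕ × ℕ}

/-- Forgets the parity of the bricks, leaving the divisibility and linear facts that most later
arguments need. -/
theorem wall_adj_cases (h : (wall m).Adj p q) :
    (m ∣ p.2 ∧ q.2 = p.2 ∧ (q.1 = p.1 + 1 ∨ p.1 = q.1 + 1)) ∨
      (m ∣ p.1 ∧ q.1 = p.1 ∧ (q.2 = p.2 + 1 ∨ p.2 = q.2 + 1)) := by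
  have key : ∀ x c : ℕ, 2 * m ∣ x + m * c → m ∣ x := fun x c hx =>
    (Nat.dvd_add_left (Dvd.intro _ rfl)).1 ((Dvd.intro_left _ rfl).trans hx)
  rcases h.2 with (⟨h1, h2, h3⟩ | ⟨h1, h2, h3⟩) | ⟨h1, h2, h3⟩ | ⟨h1, h2, h3⟩
  · exact Or.inl ⟨h1, h2, Or.inl h3⟩
  · exact Or.inr ⟨key _ _ h1, h2, Or.inl h3⟩
  · exact Or.inl ⟨h2 ▸ h1, h2.symm, Or.inr h3⟩
  · exact Or.inr ⟨key _ _ (h2 ▸ h1), h2.symm, Or.inr h3⟩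

/-- Vertical lines in consecutive bands are shifted by `m` modulo `2 * m`; an edge up and an edge
down at the same vertex would give `2 * m ∣ m`. -/
theorem wall_vertical_unique (hm : 0 < m) {r : ℕ × ℕ} (hp : m ∣ p.2) (hq : (wall m).Adj p q)
    (hr : (wall m).Adj p r) (hqp : q.1 = p.1) (hrp : r.1 = p.1) : q = r := by
  have up : ∀ s : ℕ × ℕ, (wall m).Adj p s → s.1 = p.1 →
      (s.2 = p.2 + 1 ∧ 2 * m ∣ p.1 + m * (p.2 / m)) ∨
        (p.2 = s.2 + 1 ∧ 2 * m ∣ p.1 + m * (s.2 / m)) := by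
    intro s hs hsp
    rcases hs.2 with (⟨h1, h2, h3⟩ | ⟨h1, h2, h3⟩) | ⟨h1, h2, h3⟩ | ⟨h1, h2, h3⟩
    · omega
    · exact Or.inl ⟨h3, h1⟩
    · omega
    · exact Or.inr ⟨h3, hsp ▸ h1⟩
  have absurd' : ∀ y, p.2 = y + 1 → 2 * m ∣ p.1 + m * (p.2 / m) → 2 * m ∣ p.1 + m * (y / m) →
      False := by
    intro y hy h1 h2
    obtain ⟨c, hc⟩ := hp
    obtain ⟨c, rfl⟩ : ∃ d, c = d + 1 := ⟨c - 1, by cases c <;> simp_all⟩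
    have e1 : p.2 / m = c + 1 := by rw [hc, Nat.mul_div_cancel_left _ hm]
    have e2 : y / m = c := by
      have : y = m * c + (m - 1) := by
        rw [mul_add] at hc
        omega
      rw [this, Nat.mul_add_div hm, Nat.div_eq_of_lt (by omega), add_zero]
    rw [e1, mul_add, mul_one, ← add_assoc] at h1
    rw [e2] at h2
    have := Nat.le_of_dvd hm ((Nat.dvd_add_right h2).1 h1)
    omega
  refine Prod.ext (by omega) ?_
  rcases up q hq hqp with ⟨h1, h2⟩ | ⟨h1, h2⟩ <;> rcases up r hr hrp with ⟨h3, h4⟩ | ⟨h3, h4⟩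
  · omega
  · exact (absurd' _ h3 h2 h4).elim
  · exact (absurd' _ h1 h4 h2).elim
  · omega

theorem wall_exists_vertical {a b c : ℕ × ℕ} (ha : (wall m).Adj p a) (hb : (wall m).Adj p b)
    (hc : (wall m).Adj p c) (hab : a ≠ b) (hac : a ≠ c) (hbc : b ≠ c) :
    a.1 = p.1 ∨ b.1 = p.1 ∨ c.1 = p.1 := by
  rw [Ne, Prod.ext_iff] at hab hac hbc
  have := wall_adj_cases ha
  have := wall_adj_cases hb
  have := wall_adj_cases hc
  omega

/-- Each direction offers only two neighbours, so both a horizontal and a vertical edge occur; they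
give `m ∣ p.2` and `m ∣ p.1`. -/
theorem wall_branch {a b c : ℕ × ℕ} (ha : (wall m).Adj p a) (hb : (wall m).Adj p b)
    (hc : (wall m).Adj p c) (hab : a ≠ b) (hac : a ≠ c) (hbc : b ≠ c) : m ∣ p.1 ∧ m ∣ p.2 := by
  rw [Ne, Prod.ext_iff] at hab hac hbc
  rcases wall_adj_cases ha with ⟨h1, h2⟩ | ⟨h1, h2⟩ <;>
  rcases wall_adj_cases hb with ⟨h3, h4⟩ | ⟨h3, h4⟩ <;>
  rcases wall_adj_cases hc with ⟨h5, h6⟩ | ⟨h5, h6⟩ <;>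
  first
  | exact ⟨‹_›, ‹_›⟩
  | omega

theorem ncard_wall_neighborSet_le {V : Type u} {f : V → ℕ × ℕ} (hf : f.Injective) (v : V) :
    (((wall m).comap f).neighborSet v).ncard ≤ 4 := by
  classical
  rw [← Set.ncard_image_of_injective _ hf]
  set p := f v with hp
  -- Truncated subtraction at the border only adds `p` itself, and a superset suffices; any constant
  -- bound would do.
  let T : Finset (ℕ × ℕ) := {(p.1 + 1, p.2), (p.1 - 1, p.2), (p.1, p.2 + 1), (p.1, p.2 - 1)}
  have hsub : f '' ((wall m).comap f).neighborSet v ⊆ (T : Set (ℕ × ℕ)) := by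
    rintro _ ⟨w, hw, rfl⟩
    have hw' : (wall m).Adj p (f w) := hw
    generalize f w = q at hw'
    obtain ⟨x, y⟩ := q
    simp only [T, Finset.coe_insert, Finset.coe_singleton, Set.mem_insert_iff,
      Set.mem_singleton_iff, Prod.mk.injEq]
    have := wall_adj_cases hw'
    dsimp only at this
    omega
  calc _ ≤ (T : Set (ℕ × ℕ)).ncard := Set.ncard_le_ncard hsub (Finset.finite_toSet _)
    _ ≤ 4 := by
      rw [Set.ncard_coe_finset]
      exact Finset.card_le_four

/-- Among any three neighbours one is vertical, so among four at least two are, against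
`wall_vertical_unique`. -/
theorem wall_not_four_neighbors (hm : 0 < m) {a b c d : ℕ × ℕ} (ha : (wall m).Adj p a)
    (hb : (wall m).Adj p b) (hc : (wall m).Adj p c) (hd : (wall m).Adj p d) (hab : a ≠ b)
    (hac : a ≠ c) (had : a ≠ d) (hbc : b ≠ c) (hbd : b ≠ d) (hcd : c ≠ d) : False := by
  have hp := (wall_branch ha hb hc hab hac hbc).2
  have hv : ∀ {x y}, (wall m).Adj p x → (wall m).Adj p y → x ≠ y → ¬ (x.1 = p.1 ∧ y.1 = p.1) :=
    fun hx hy hxy h => hxy (wall_vertical_unique hm hp hx hy h.1 h.2)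
  have := wall_exists_vertical ha hb hc hab hac hbc
  have := wall_exists_vertical ha hb hd hab had hbd
  have := wall_exists_vertical ha hc hd hac had hcd
  have := wall_exists_vertical hb hc hd hbc hbd hcd
  have := hv ha hb hab
  have := hv ha hc hac
  have := hv ha hd had
  have := hv hb hc hbc
  have := hv hb hd hbd
  have := hv hc hd hcd
  omega

/-! ### The forbidden graphs are not even non-induced subgraphs of the wall. -/

theorem K14_not_isContained_wall (hm : 0 < m) : ¬ K14.graph ⊑ wall m := by
  rintro ⟨f⟩
  change Copy (completeBipartiteGraph (Fin 1) (Fin 4)) (wall m) at f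
  have hadj : ∀ i : Fin 4, (wall m).Adj (f (Sum.inl 0)) (f (Sum.inr i)) := fun i =>
    f.toHom.map_adj (Or.inl ⟨rfl, rfl⟩)
  have hne : ∀ i j : Fin 4, i ≠ j → f (Sum.inr i) ≠ f (Sum.inr j) := fun i j hij h =>
    hij (Sum.inr_injective (f.injective h))
  exact wall_not_four_neighbors hm (hadj 0) (hadj 1) (hadj 2) (hadj 3) (hne _ _ (by decide))
    (hne _ _ (by decide)) (hne _ _ (by decide)) (hne _ _ (by decide)) (hne _ _ (by decide))
    (hne _ _ (by decide))

theorem wall_walk_bound {f : ℕ → ℕ × ℕ} {n : ℕ} (hf : ∀ i < n, (wall m).Adj (f i) (f (i + 1))) :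
    ∀ i ≤ n, (f i).1 ≤ (f 0).1 + i ∧ (f 0).1 ≤ (f i).1 + i ∧
      (f i).2 ≤ (f 0).2 + i ∧ (f 0).2 ≤ (f i).2 + i := by
  intro i
  induction i with
  | zero => omega
  | succ i ih =>
    intro hi
    have := ih (by omega)
    have := wall_adj_cases (hf i (by omega))
    omega

theorem eq_of_dvd_of_close {a b d : ℕ} (ha : m ∣ a) (hb : m ∣ b) (hab : a ≤ b + d)
    (hba : b ≤ a + d) (hd : d < m) : a = b := by
  rcases le_total a b with h | h
  · have := Nat.eq_zero_of_dvd_of_lt (Nat.dvd_sub hb ha) (by omega)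
    omega
  · have := Nat.eq_zero_of_dvd_of_lt (Nat.dvd_sub ha hb) (by omega)
    omega

/-- Both ends of the path have three neighbours, so their coordinates are multiples of `m`; being
fewer than `m` steps apart, they coincide. -/
theorem graphH_not_isContained_wall {i : ℕ} (hi : 1 ≤ i) (him : i < m) :
    ¬ (graphH i).graph ⊑ wall m := by
  rintro ⟨f⟩
  have hpath : ∀ a b : Fin (i + 1), (a : ℕ) + 1 = b →
      (wall m).Adj (f (Sum.inl a)) (f (Sum.inl b)) := by
    intro a b hab
    refine f.toHom.map_adj ⟨fun h => ?_, Or.inl hab⟩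
    have := Sum.inl_injective h
    subst this
    omega
  have hpend : ∀ e c : Bool,
      (wall m).Adj (f (Sum.inl (if e then Fin.last i else 0))) (f (Sum.inr (e, c))) :=
    fun e c => f.toHom.map_adj ⟨fun h => (Sum.inl_ne_inr h).elim, Or.inl rfl⟩
  have hne : ∀ {x y : (graphH i).V}, x ≠ y → f x ≠ f y := fun h h' => h (f.injective h')
  have hpe {e : Bool} : (Sum.inr (e, false) : Fin (i + 1) ⊕ (Bool × Bool)) ≠ Sum.inr (e, true) := by
    simp
  -- Only indices up to `i` are used, so the wrap-around of `Fin.ofNat` plays no role.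
  let g : ℕ → ℕ × ℕ := fun a => f (Sum.inl (Fin.ofNat (i + 1) a))
  have hg : ∀ a < i, (wall m).Adj (g a) (g (a + 1)) := fun a ha => hpath _ _ (by
    rw [Fin.val_ofNat, Fin.val_ofNat, Nat.mod_eq_of_lt (by omega), Nat.mod_eq_of_lt (by omega)])
  have h0 : g 0 = f (Sum.inl 0) := rfl
  have hlast : g i = f (Sum.inl (Fin.last i)) := by
    simp only [g]
    congr 2
    exact Fin.ext (by simp)
  have b0 : m ∣ (g 0).1 ∧ m ∣ (g 0).2 :=
    wall_branch (hpend false false) (hpend false true) (hg 0 hi) (hne hpe)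
      (hne Sum.inr_ne_inl) (hne Sum.inr_ne_inl)
  have bi : m ∣ (g i).1 ∧ m ∣ (g i).2 := by
    have hprev := hg (i - 1) (by omega)
    rw [Nat.sub_add_cancel hi] at hprev
    have hl : ∀ c, (wall m).Adj (g i) (f (Sum.inr (true, c))) := fun c => hlast ▸ hpend true c
    exact wall_branch (hl false) (hl true) hprev.symm (hne hpe)
      (hne Sum.inr_ne_inl) (hne Sum.inr_ne_inl)
  have hb := wall_walk_bound hg i le_rfl
  have : g 0 = g i := Prod.ext
    (eq_of_dvd_of_close b0.1 bi.1 hb.2.1 hb.1 him)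
    (eq_of_dvd_of_close b0.2 bi.2 hb.2.2.2 hb.2.2.1 him)
  rw [h0, hlast] at this
  have := congrArg Fin.val (Sum.inl_injective (f.injective this))
  simp at this
  omega

/-- Where `x + y` is extremal on the cycle, the cycle turns, so both coordinates are multiples of
`m`. On a short cycle the maximum and minimum points then coincide, although `x + y` changes along
every edge. -/
theorem cycle_not_isContained_wall {n : ℕ} (hn : 3 ≤ n) (hnm : 2 * n < m) :
    ¬ (cycle n).graph ⊑ wall m := by
  rintro ⟨f⟩
  obtain ⟨n, rfl⟩ : ∃ k, n = k + 3 := ⟨n - 3, by omega⟩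
  change Copy (cycleGraph (n + 3)) (wall m) at f
  have hsucc : ∀ a : Fin (n + 3), (wall m).Adj (f a) (f (a + 1)) := fun a =>
    f.toHom.map_adj (cycleGraph_adj.2 (Or.inr (by simp)))
  have hpred : ∀ a : Fin (n + 3), (wall m).Adj (f a) (f (a - 1)) := fun a =>
    f.toHom.map_adj (cycleGraph_adj.2 (Or.inl (by simp)))
  have hne : ∀ a : Fin (n + 3), f (a + 1) ≠ f (a - 1) := fun a h => by
    have h1 := f.injective h
    have h2 : (1 : Fin (n + 3)) + 1 = 0 := by
      have := congrArg (fun z => z - a + 1) h1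
      simpa [add_assoc] using this
    have h3 := congrArg Fin.val h2
    rw [Fin.val_add] at h3
    simp [Nat.mod_eq_of_lt (show 2 < n + 3 by omega)] at h3
  let s : Fin (n + 3) → ℕ := fun a => (f a).1 + (f a).2
  obtain ⟨a, -, ha⟩ := Finset.exists_max_image Finset.univ s ⟨0, Finset.mem_univ _⟩
  obtain ⟨b, -, hb⟩ := Finset.exists_min_image Finset.univ s ⟨0, Finset.mem_univ _⟩
  have extremal : ∀ c, (s (c + 1) ≤ s c ∧ s (c - 1) ≤ s c) ∨ (s c ≤ s (c + 1) ∧ s c ≤ s (c - 1)) →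
      m ∣ (f c).1 ∧ m ∣ (f c).2 := by
    intro c hc
    have h := hne c
    rw [Ne, Prod.ext_iff] at h
    simp only [s] at hc
    rcases wall_adj_cases (hsucc c) with ⟨h1, h2⟩ | ⟨h1, h2⟩ <;>
    rcases wall_adj_cases (hpred c) with ⟨h3, h4⟩ | ⟨h3, h4⟩ <;>
    first
    | exact ⟨‹_›, ‹_›⟩
    | omega
  have da := extremal a (Or.inl ⟨ha _ (Finset.mem_univ _), ha _ (Finset.mem_univ _)⟩)
  have db := extremal b (Or.inr ⟨hb _ (Finset.mem_univ _), hb _ (Finset.mem_univ _)⟩)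
  have bound : ∀ c : Fin (n + 3), (f c).1 ≤ (f 0).1 + c ∧ (f 0).1 ≤ (f c).1 + c ∧
      (f c).2 ≤ (f 0).2 + c ∧ (f 0).2 ≤ (f c).2 + c := by
    intro c
    have := wall_walk_bound (m := m) (f := fun i => f (Fin.ofNat (n + 3) i)) (n := c)
      (fun i _ => by
        have h := hsucc (Fin.ofNat (n + 3) i)
        have e : Fin.ofNat (n + 3) (i + 1) = Fin.ofNat (n + 3) i + 1 := by
          ext
          simp [Fin.val_add]
        rwa [← e] at h) c le_rfl
    simpa using this
  have ba := bound a
  have bb := bound b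
  -- The distance from `a` to `b` is estimated through vertex `0`, whence the factor 2.
  have h1 : (f a).1 = (f b).1 := eq_of_dvd_of_close (d := 2 * (n + 3)) da.1 db.1
    (by omega) (by omega) hnm
  have h2 : (f a).2 = (f b).2 := eq_of_dvd_of_close (d := 2 * (n + 3)) da.2 db.2
    (by omega) (by omega) hnm
  have hs := ha (a + 1) (Finset.mem_univ _)
  have hs' := hb (a + 1) (Finset.mem_univ _)
  have := wall_adj_cases (hsucc a)
  simp only [s] at hs hs'
  omega

theorem forbidden_not_isContained_wall {k : ℕ} {A : FinGraph.{0}} (hA : A ∈ forbidden k) :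
    ¬ A.graph ⊑ wall (2 * k + 1) := by
  rcases hA with (rfl | ⟨n, ⟨h3, hk⟩, rfl⟩) | ⟨i, ⟨h1, hk⟩, rfl⟩
  · exact K14_not_isContained_wall (by omega)
  · exact cycle_not_isContained_wall h3 (by omega)
  · exact graphH_not_isContained_wall h1 (by omega)

/-- Allowing non-induced containment matters for line graphs, where arbitrary subgraphs of the wall
arise. -/
theorem mem_classS_of_isContained_wall {k : ℕ} {G : FinGraph.{u}}
    (hG : G.graph ⊑ wall (2 * k + 1)) : G ∈ classS.{u} k :=
  fun _ hA h => forbidden_not_isContained_wall hA (h.isContained.trans hG)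

/-! ### Rows and zigzag columns of the wall. -/

theorem wall_joinedIn_horizontal {m x y : ℕ} {S : Set (ℕ × ℕ)} (hy : m ∣ y) (d : ℕ)
    (hS : ∀ e ≤ d, (x + e, y) ∈ S) : JoinedIn (wall m) S (x, y) (x + d, y) := by
  induction d with
  | zero => exact .refl
  | succ d ih =>
    refine (ih fun e he => hS e (by omega)).tail ⟨⟨?_, Or.inl (Or.inl ⟨hy, rfl, rfl⟩)⟩,
      hS d (by omega), hS (d + 1) le_rfl⟩
    simp [Prod.ext_iff]

theorem wall_joinedIn_vertical {m x c : ℕ} {S : Set (ℕ × ℕ)} (hx : 2 * m ∣ x + m * c)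
    (d : ℕ) (hd : d ≤ m) (hS : ∀ e ≤ d, (x, m * c + e) ∈ S) :
    JoinedIn (wall m) S (x, m * c) (x, m * c + d) := by
  induction d with
  | zero => exact .refl
  | succ d ih =>
    have hdiv : (m * c + d) / m = c := by
      rw [Nat.mul_add_div (by omega), Nat.div_eq_of_lt (by omega), add_zero]
    refine (ih (by omega) fun e he => hS e (by omega)).tail
      ⟨⟨?_, Or.inl (Or.inr ⟨?_, rfl, rfl⟩)⟩, hS d (by omega), hS (d + 1) le_rfl⟩
    · simp [Prod.ext_iff]
    · rwa [hdiv]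

/-- In even bands the column climbs along `x = 2 * m * j`; in odd bands the vertical line is `m`
further right, so it goes right, up and back. It thus meets every row at `x = 2 * m * j`. -/
theorem wall_joinedIn_column {m n j : ℕ} {S : Set (ℕ × ℕ)}
    (hS : ∀ x y, 2 * m * j ≤ x → x ≤ 2 * m * j + m → y ≤ m * n → (x, y) ∈ S) (i : ℕ) (hi : i ≤ n) :
    JoinedIn (wall m) S (2 * m * j, m * 0) (2 * m * j, m * i) := by
  induction i with
  | zero => exact .refl
  | succ i ih =>
    have hi' : m * i + m ≤ m * n := Nat.mul_le_mul_left m hi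
    refine (ih (by omega)).trans ?_
    rcases Nat.even_or_odd' i with ⟨c, rfl | rfl⟩
    · exact wall_joinedIn_vertical ⟨j + c, by ring⟩ m le_rfl
        fun e he => hS _ _ le_rfl (by omega) (by omega)
    · have h1 : JoinedIn (wall m) S (2 * m * j, m * (2 * c + 1)) (2 * m * j + m, m * (2 * c + 1)) :=
        wall_joinedIn_horizontal ⟨_, rfl⟩ m fun e he => hS _ _ (by omega) (by omega) (by omega)
      have h2 : JoinedIn (wall m) S (2 * m * j + m, m * (2 * c + 1))
          (2 * m * j + m, m * (2 * c + 1 + 1)) :=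
        wall_joinedIn_vertical ⟨j + c + 1, by ring⟩ m le_rfl
          fun e he => hS _ _ (by omega) (by omega) (by omega)
      have h3 : JoinedIn (wall m) S (2 * m * j, m * (2 * c + 1 + 1))
          (2 * m * j + m, m * (2 * c + 1 + 1)) :=
        wall_joinedIn_horizontal ⟨_, rfl⟩ m
          fun e he => hS _ _ (by omega) (by omega) (by rw [mul_add m (2 * c + 1)]; omega)
      exact (h1.trans h2).trans h3.symm

theorem le_of_mul_le_mul_add {m x i j : ℕ} (hm : 0 < m) (h1 : 2 * m * i ≤ x)
    (h2 : x ≤ 2 * m * j + m) : i ≤ j := by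
  by_contra! h
  have : 2 * m * (j + 1) ≤ 2 * m * i := Nat.mul_le_mul_left _ h
  rw [mul_add] at this
  omega

theorem mul_add_two_mul_le {m n j : ℕ} (hj : j < n) : 2 * m * j + 2 * m ≤ 2 * m * n :=
  Nat.mul_le_mul_left (2 * m) hj

/-- The horizontal lines and the zigzag columns of the wall. -/
def wallModel (m n : ℕ) (hm : 0 < m) : GridModel (wall m) n where
  row i := {p | p.2 = m * i ∧ p.1 ≤ 2 * m * n}
  col j := {p | 2 * m * j ≤ p.1 ∧ p.1 ≤ 2 * m * j + m ∧ p.2 ≤ m * n}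
  t i j := (2 * m * j, m * i)
  row_unique h h' := Fin.ext (Nat.eq_of_mul_eq_mul_left hm (h.1.symm.trans h'.1))
  col_unique h h' := Fin.ext (le_antisymm (le_of_mul_le_mul_add hm h.1 h'.2.1)
    (le_of_mul_le_mul_add hm h'.1 h.2.1))
  mem_row i j := ⟨rfl, Nat.mul_le_mul_left _ j.2.le⟩
  mem_col i j := ⟨le_rfl, Nat.le_add_right _ _, Nat.mul_le_mul_left _ i.2.le⟩
  row_joined i j j' := by
    -- Every terminal is joined to the left end of its row.
    have h : ∀ j : Fin n, JoinedIn (wall m) {p | p.2 = m * i ∧ p.1 ≤ 2 * m * n}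
        (0, m * i) (0 + 2 * m * j, m * i) := fun j =>
      wall_joinedIn_horizontal ⟨_, rfl⟩ _ fun e he => ⟨rfl, by
        have := mul_add_two_mul_le (m := m) j.2
        dsimp only
        omega⟩
    have h' := (h j).symm.trans (h j')
    rwa [zero_add, zero_add] at h'
  col_joined i i' j := by
    have h := wall_joinedIn_column (m := m) (n := n) (j := j)
      (S := {p | 2 * m * j ≤ p.1 ∧ p.1 ≤ 2 * m * j + m ∧ p.2 ≤ m * n})
      fun x y h1 h2 h3 => ⟨h1, h2, h3⟩
    exact (h i i.2.le).symm.trans (h i' i'.2.le)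

/-- The coordinates of a vertex of the finite wall. -/
def wallCoord (N : ℕ) (v : ULift.{u} (Fin N × Fin N)) : ℕ × ℕ := (v.down.1, v.down.2)

theorem wallCoord_injective (N : ℕ) : (wallCoord.{u} N).Injective := by
  rintro ⟨a, b⟩ ⟨c, d⟩ h
  exact congrArg ULift.up (Prod.ext (Fin.ext (congrArg Prod.fst h)) (Fin.ext (congrArg Prod.snd h)))

/-- A finite square piece of the wall. -/
def finiteWall (m N : ℕ) : FinGraph.{u} where
  V := ULift.{u} (Fin N × Fin N)
  graph := (wall m).comap (wallCoord N)

/-- The line graph of a finite graph. -/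
def FinGraph.line (G : FinGraph.{u}) : FinGraph.{u} where
  V := G.graph.edgeSet
  graph := G.graph.lineGraph

theorem finiteWall_isContained (m N : ℕ) : (finiteWall.{u} m N).graph ⊑ wall m :=
  ⟨⟨⟨wallCoord N, fun h => h⟩, wallCoord_injective N⟩⟩

theorem exists_wallCoord_eq {N : ℕ} {p : ℕ × ℕ} (h1 : p.1 < N) (h2 : p.2 < N) :
    p ∈ Set.range (wallCoord.{u} N) :=
  ⟨⟨⟨p.1, h1⟩, ⟨p.2, h2⟩⟩, rfl⟩

theorem wallModel_row_subset {m n : ℕ} (hm : 0 < m) (i : Fin n) :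
    (wallModel m n hm).row i ⊆ Set.range (wallCoord.{u} (2 * m * n + 1)) := by
  rintro p ⟨h1, h2⟩
  have h : m * i ≤ m * n := Nat.mul_le_mul_left _ i.2.le
  exact exists_wallCoord_eq (by omega) (by rw [mul_assoc]; omega)

theorem wallModel_col_subset {m n : ℕ} (hm : 0 < m) (j : Fin n) :
    (wallModel m n hm).col j ⊆ Set.range (wallCoord.{u} (2 * m * n + 1)) := by
  rintro p ⟨-, h1, h2⟩
  have := mul_add_two_mul_le (m := m) j.2
  refine exists_wallCoord_eq (by omega) ?_
  rw [mul_assoc]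
  omega

/-- The grid model of the finite wall. -/
noncomputable def finiteWallModel (m n : ℕ) (hm : 0 < m) :
    GridModel (finiteWall.{u} m (2 * m * n + 1)).graph n :=
  (wallModel m n hm).comap (wallCoord _) (wallCoord_injective _)
    (fun i j => (wallModel_row_subset hm i ((wallModel m n hm).mem_row i j)).choose)
    (fun i j => (wallModel_row_subset hm i ((wallModel m n hm).mem_row i j)).choose_spec)
    (wallModel_row_subset hm) (wallModel_col_subset hm)

/-- The right-hand neighbour serves: a column contains the whole strip of width `m ≥ 1` to the right
of its terminals. -/
theorem exists_wall_companion {m n : ℕ} (hm : 0 < m) (i j : Fin n) :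
    ∃ s, (finiteWall.{u} m (2 * m * n + 1)).graph.Adj ((finiteWallModel m n hm).t i j) s ∧
      s ∈ (finiteWallModel.{u} m n hm).row i ∧ s ∈ (finiteWallModel.{u} m n hm).col j := by
  have hj := mul_add_two_mul_le (m := m) j.2
  have hrow : (2 * m * j + 1, m * i) ∈ (wallModel m n hm).row i := ⟨rfl, by dsimp only; omega⟩
  have hcol : (2 * m * j + 1, m * i) ∈ (wallModel m n hm).col j :=
    ⟨Nat.le_add_right _ _, Nat.add_le_add_left hm _, Nat.mul_le_mul_left _ i.2.le⟩
  obtain ⟨s, hs⟩ := wallModel_row_subset.{u} hm i hrow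
  have ht : wallCoord _ ((finiteWallModel.{u} m n hm).t i j) = (2 * m * j, m * i) :=
    (wallModel_row_subset hm i ((wallModel m n hm).mem_row i j)).choose_spec
  refine ⟨s, ?_, ?_, ?_⟩
  · change (wall m).Adj (wallCoord _ _) (wallCoord _ s)
    rw [ht, hs]
    exact ⟨by simp [Prod.ext_iff], Or.inl (Or.inl ⟨⟨i, rfl⟩, rfl, rfl⟩)⟩
  · change wallCoord _ s ∈ (wallModel m n hm).row i
    rwa [hs]
  · change wallCoord _ s ∈ (wallModel m n hm).col j
    rwa [hs]

/-! ### Unbounded clique-width of powers -/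

/-- A class whose members include graphs of bounded degree with arbitrarily large grid models. -/
theorem powerUnbounded_of_gridModel {𝒢 : Set FinGraph.{u}} (D : ℕ)
    (h : ∀ n, ∃ G ∈ 𝒢, (∀ v, (G.graph.neighborSet v).ncard ≤ D) ∧ Nonempty (GridModel G.graph n)) :
    PowerUnboundedCliqueWidth 𝒢 := by
  rintro ⟨p, hp, htop⟩
  obtain ⟨w, hw⟩ := ENat.ne_top_iff_exists.1 htop.ne
  obtain ⟨G, hG, hD, ⟨M⟩⟩ := h (2 * (w * (D + 1) ^ p) + 2)
  have hle : cliqueWidth (G.power p) ≤ w :=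
    hw ▸ le_iSup₂ (f := fun H (_ : H ∈ classPower 𝒢 p) => cliqueWidth H) _ ⟨G, hG, rfl⟩
  obtain ⟨k, hk, hb⟩ := cliqueWidth_le_iff.1 hle
  refine M.not_buildableWith_power hD hp (by omega) ?_ hb
  have := Nat.mul_le_mul_right ((D + 1) ^ p) hk
  omega

/-- Every induced subgraph of a line graph is the line graph of a subgraph. -/
theorem exists_lineGraph_iso_of_isIndContained {V : Type u} {W : Type v} {G : SimpleGraph V}
    {A : SimpleGraph W} (h : A ⊴ G.lineGraph) :
    ∃ R : SimpleGraph V, R ≤ G ∧ Nonempty (A ≃g R.lineGraph) := by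
  obtain ⟨f⟩ := h
  let E : Set (Sym2 V) := Set.range fun a => (f a : Sym2 V)
  have hE : (fromEdgeSet E).edgeSet = E := by
    rw [edgeSet_fromEdgeSet]
    refine sdiff_eq_left.2 (Set.disjoint_left.2 ?_)
    rintro _ ⟨a, rfl⟩ hd
    exact G.not_isDiag_of_mem_edgeSet (f a).2 hd
  -- All vertices of `V` are kept; isolated ones do not affect the line graph.
  refine ⟨fromEdgeSet E, ?_, ⟨⟨Equiv.ofBijective
    (fun a => ⟨f a, hE.symm ▸ ⟨a, rfl⟩⟩) ⟨fun a b hab => ?_, ?_⟩, ?_⟩⟩⟩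
  · rw [← edgeSet_subset_edgeSet, hE]
    rintro _ ⟨a, rfl⟩
    exact (f a).2
  · have h := Subtype.mk.inj hab
    exact f.injective (Subtype.ext h)
  · rintro ⟨e, he⟩
    obtain ⟨a, rfl⟩ := hE ▸ he
    exact ⟨a, rfl⟩
  · intro a b
    rw [← f.map_rel_iff]
    simp [lineGraph, Subtype.ext_iff]

/-- Stated for any family `C`, to serve `kappaSet` and `lambdaSet` alike. -/
theorem exists_notMem_of_iSup_lt_top {α : Type u} {ℱ : Set α} {C : ℕ → Set α}
    (h : ⨆ G ∈ ℱ, ⨆ (k : ℕ) (_ : 3 ≤ k ∧ G ∈ C k), (k : ℕ∞) < ⊤) :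
    ∃ k, ∀ G ∈ ℱ, G ∉ C k := by
  obtain ⟨w, hw⟩ := ENat.ne_top_iff_exists.1 h.ne
  -- `w + 3` exceeds the supremum `w` and is at least 3.
  refine ⟨w + 3, fun G hG hC => ?_⟩
  have h1 : ((w + 3 : ℕ) : ℕ∞) ≤ w := by
    rw [hw]
    exact le_iSup₂_of_le G hG (le_iSup₂_of_le (w + 3) ⟨by omega, hC⟩ le_rfl)
  have := Nat.cast_le.1 h1
  omega

end PowerCW

theorem mainTheorem7 (ℱ : Set PowerCW.FinGraph.{u})
    (hℱ : PowerCW.kappaSet ℱ < ⊤ ∨ PowerCW.lambdaSet ℱ < ⊤) :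
    PowerCW.PowerUnboundedCliqueWidth (PowerCW.Free.{u, u} ℱ) := by
  rcases hℱ with h | h
  · obtain ⟨k, hk⟩ := PowerCW.exists_notMem_of_iSup_lt_top h
    refine PowerCW.powerUnbounded_of_gridModel 4 fun n =>
      ⟨PowerCW.finiteWall (2 * k + 1) _, fun A hA hAG => hk A hA ?_,
        PowerCW.ncard_wall_neighborSet_le (PowerCW.wallCoord_injective _),
        ⟨PowerCW.finiteWallModel _ n (by omega)⟩⟩
    exact PowerCW.mem_classS_of_isContained_wall
      (hAG.isContained.trans (PowerCW.finiteWall_isContained _ _))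
  · obtain ⟨k, hk⟩ := PowerCW.exists_notMem_of_iSup_lt_top h
    refine PowerCW.powerUnbounded_of_gridModel (4 + 4) fun n =>
      ⟨(PowerCW.finiteWall (2 * k + 1) (2 * (2 * k + 1) * n + 1)).line,
        fun A hA hAG => hk A hA ?_, ?_, ?_⟩
    -- `R` is a subgraph of the wall, so it lies in `S_k` and `A` lies in `T_k`.
    · obtain ⟨R, hR, ⟨e⟩⟩ := PowerCW.exists_lineGraph_iso_of_isIndContained hAG
      exact ⟨⟨_, R⟩, PowerCW.mem_classS_of_isContained_wall
        ((SimpleGraph.IsContained.of_le hR).trans (PowerCW.finiteWall_isContained _ _)), ⟨e⟩⟩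
    · exact PowerCW.ncard_neighborSet_lineGraph_le
        (PowerCW.ncard_wall_neighborSet_le (PowerCW.wallCoord_injective _))
    · choose s hs using PowerCW.exists_wall_companion (m := 2 * k + 1) (n := n) (by omega)
      exact ⟨(PowerCW.finiteWallModel _ n (by omega)).lineGraph s (fun i j => (hs i j).1)
        (fun i j => (hs i j).2.1) fun i j => (hs i j).2.2⟩
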